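/- All graphs are finite and simple. For positive integers $n,d$ with $n\ge 2d$, the circular complete graph $K_{n/d}$ has vertex set $\{0,1,\dots,n-1\}$, with $i,j$ adjacent if and only if $d\le |i-j|\le n-d$ (the pair $(n,d)$ need not be coprime). For a graph $G$, a vertex $v$ and an integer $i\ge 0$, let $N_i(v)$ be the set of vertices joined to $v$ by a walk of length exactly $i$. For a non-negative integer $r$, the dual power $G^{\frac{1}{\widetilde{2r+1}}}$ is the graph whose vertices are the tuples $(A_1,\dots,A_{r+1})$ of nonempty subsets of $V(G)$ such that $A_1=\{v\}$ is a singleton and $A_i\subseteq N_{i-1}(v)$ for all $1\le i\le r+1$; two vertices $(A_1,\dots,A_{r+1})$ and $(B_1,\dots,B_{r+1})$ are adjacent if and only if $A_i\subseteq B_{i+1}$ and $B_i\subseteq A_{i+1}$ for all $1\le i\le r$, and, for all $1\le j\le r+1$, every vertex of $A_j$ is adjacent in $G$ to every vertex of $B_j$. Two graphs $G,H$ are homomorphically equivalent, written $G\longleftrightarrow H$, if there are graph homomorphisms $G\to H$ and $H\to G$. **Lemma.** Let $n$ and $d$ be positive integers with $n>2d$, and let $r$ be a non-negative integer. If $\frac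 nd<4$, then $$K_{n/d}^{\frac{1}{\widetilde{2r+1}}}\longleftrightarrow K_{\frac{(2r+1)n}{rn+d}}.$$ -/

import Mathlib

/-- The circular complete graph `K_{n/d}`: vertices `0, …, n - 1`, with `i` and `j` adjacent
iff `d ≤ |i - j| ≤ n - d`. For `d ≥ 1` the clause `i ≠ j` is automatic. -/
def circularCompleteGraph (n d : ℕ) : SimpleGraph (Fin n) where
  Adj i j := i ≠ j ∧ (d : ℤ) ≤ |(i : ℤ) - (j : ℤ)| ∧ |(i : ℤ) - (j : ℤ)| ≤ (n : ℤ) - (d : ℤ)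
  symm := ⟨fun i j h => ⟨h.1.symm, by rw [abs_sub_comm]; exact h.2⟩⟩
  loopless := ⟨fun _ h => h.1 rfl⟩

/-- `N_i(v)`: the vertices joined to `v` by a walk of length exactly `i`. -/
def walkNeighborSet {V : Type*} (G : SimpleGraph V) (i : ℕ) (v : V) : Set V :=
  {u | ∃ p : G.Walk v u, p.length = i}

/-- `A ⋈ B`: every vertex of `A` is adjacent to every vertex of `B`. -/
def CompletelyJoined {V : Type*} (G : SimpleGraph V) (A B : Set V) : Prop :=
  ∀ a ∈ A, ∀ b ∈ B, G.Adj a b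

/-- Vertices of the dual root of order `2s + 1`: tuples `(A_1, …, A_{s+1})` of nonempty vertex
sets such that `A_1 = {v}` is a singleton and `A_i ⊆ N_{i-1}(v)`. The set `A_{i+1}` is
`sets i` for `i = 0, …, s`. -/
structure DualRootVertex {V : Type*} (G : SimpleGraph V) (s : ℕ) where
  sets : Fin (s + 1) → Set V
  nonempty : ∀ i, (sets i).Nonempty
  rooted : ∃ v, sets 0 = {v} ∧ ∀ i : Fin (s + 1), sets i ⊆ walkNeighborSet G (i : ℕ) v

/-- The dual root of `G` of order `2s + 1`, that is, the dual power with exponent `1/(2s+1)`: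
`(A_i)` and `(B_i)` are adjacent iff `A_i ⊆ B_{i+1}` and `B_i ⊆ A_{i+1}` for `1 ≤ i ≤ s`, and
`A_j ⋈ B_j` for `1 ≤ j ≤ s + 1`. -/
def dualRoot {V : Type*} (G : SimpleGraph V) (s : ℕ) : SimpleGraph (DualRootVertex G s) where
  Adj A B :=
    (∀ i : Fin s, A.sets i.castSucc ⊆ B.sets i.succ ∧ B.sets i.castSucc ⊆ A.sets i.succ) ∧
      ∀ j : Fin (s + 1), CompletelyJoined G (A.sets j) (B.sets j)
  symm := ⟨fun _ _ h =>
    ⟨fun i => (h.1 i).symm, fun j b hb a ha => (h.2 j a ha b hb).symm⟩⟩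
  loopless := ⟨fun A h => by
    obtain ⟨a, ha⟩ := A.nonempty 0
    exact G.loopless.irrefl a (h.2 0 a ha a ha)⟩

/-- Two graphs are homomorphically equivalent if each maps homomorphically to the other. -/
def HomEquivalent {V W : Type*} (G : SimpleGraph V) (H : SimpleGraph W) : Prop :=
  Nonempty (G →g H) ∧ Nonempty (H →g G)

/-!
Call a vertex map an odd walk homomorphism if it sends the ends of every odd walk of length at most
`2r + 1` to adjacent vertices. For `G` without isolated vertices, there is such a map `c` from `G`
to `H` exactly when there is a homomorphism from `G` to the dual root of `H`: map `x` to the tuple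
`A_{i+1} = c(N_i(x))`, and conversely a tuple to its root `v`. So it is enough that `K_{n/d}` has
the same relation to `K_{(2r+1)n/(rn+d)}`.

For `H = K_{n/d}`, think of the vertices as points on a circle of length `n` and let a walk move
anticlockwise along each of its edges. If `n < 4d`, an odd walk homomorphism makes each walk of
length `2k + 1 ≤ 2r + 1` move by between `kn + d` and `kn + n - d`: adding two edges to a walk
increases its displacement by an amount between `2d` and `2(n - d)`, which leaves only one possible
number of full turns. Hence no walk moves on average by more than `(rn + n - d) / (2r + 1)` per
edge, up to a bounded error, and a potential for the excess corrects `(2r + 1)c` to a homomorphism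
to `K_{(2r+1)n/(rn+d)}`. Conversely, a walk of length `2k + 1` in `K_{(2r+1)n/(rn+d)}` is already
forced into the corresponding range, and division by `2r + 1` is an odd walk homomorphism.
-/

/-! ### Odd walk homomorphisms and dual roots -/

/-- A vertex map is an odd walk homomorphism of order `r` if the ends of every odd walk of length
at most `2r + 1` have adjacent images. Such maps are another form of the homomorphisms to the dual
root of order `2r + 1`. -/
def IsOddWalkHom {V W : Type*} (G : SimpleGraph V) (H : SimpleGraph W) (r : ℕ) (c : V → W) : Prop :=
  ∀ k ≤ r, ∀ ⦃u v⦄ (p : G.Walk u v), p.length = 2 * k + 1 → H.Adj (c u) (c v)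

theorem walkNeighborSet_zero {V : Type*} (G : SimpleGraph V) (v : V) :
    walkNeighborSet G 0 v = {v} := by
  ext u
  constructor
  · rintro ⟨p, hp⟩
    exact (SimpleGraph.Walk.eq_of_length_eq_zero hp).symm
  · rintro rfl
    exact ⟨.nil, rfl⟩

theorem walkNeighborSet_nonempty {V : Type*} {G : SimpleGraph V} (hG : ∀ v, ¬ G.IsIsolated v)
    (i : ℕ) (v : V) : (walkNeighborSet G i v).Nonempty := by
  induction i generalizing v with
  | zero => exact ⟨v, .nil, rfl⟩
  | succ i ih =>
    obtain ⟨w, hw⟩ := G.exists_adj_iff_not_isIsolated.2 (hG v)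
    obtain ⟨u, p, hp⟩ := ih w
    exact ⟨u, .cons hw p, congrArg (· + 1) hp⟩

theorem walkNeighborSet_subset_succ_of_adj {V : Type*} {G : SimpleGraph V} {u v : V}
    (h : G.Adj u v) (i : ℕ) : walkNeighborSet G i u ⊆ walkNeighborSet G (i + 1) v := by
  rintro z ⟨p, hp⟩
  exact ⟨.cons h.symm p, congrArg (· + 1) hp⟩

namespace IsOddWalkHom

variable {U V W : Type*} {F : SimpleGraph U} {G : SimpleGraph V} {H : SimpleGraph W} {r : ℕ}
  {c : V → W}

theorem adj (hc : IsOddWalkHom G H r c) {u v : V} (h : G.Adj u v) : H.Adj (c u) (c v) :=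
  hc 0 (Nat.zero_le r) (.cons h .nil) rfl

/-- The case of walks of length one: an odd walk homomorphism is a graph homomorphism. -/
def toHom (hc : IsOddWalkHom G H r c) : G →g H := ⟨c, hc.adj⟩

@[simp]
theorem coe_toHom (hc : IsOddWalkHom G H r c) : ⇑hc.toHom = c := rfl

theorem hom_comp {b : U → V} (f : G →g H) (hb : IsOddWalkHom F G r b) :
    IsOddWalkHom F H r (f ∘ b) :=
  fun k hk _ _ p hp => f.map_adj (hb k hk p hp)

theorem completelyJoined_image_walkNeighborSet (hc : IsOddWalkHom G H r c) {x y : V}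
    (h : G.Adj x y) {i : ℕ} (hi : i ≤ r) :
    CompletelyJoined H (c '' walkNeighborSet G i x) (c '' walkNeighborSet G i y) := by
  rintro _ ⟨u, ⟨p, hp⟩, rfl⟩ _ ⟨v, ⟨q, hq⟩, rfl⟩
  refine hc i hi (p.reverse.append (.cons h q)) ?_
  rw [SimpleGraph.Walk.length_append, SimpleGraph.Walk.length_reverse,
    SimpleGraph.Walk.length_cons, hp, hq]
  ring

/-- The vertex `A_{i+1} = c(N_i(x))` of the dual root of `H` that an odd walk homomorphism `c`
assigns to `x`. -/
def dualRootVertex (hc : IsOddWalkHom G H r c) (hG : ∀ v, ¬ G.IsIsolated v) (x : V) :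
    DualRootVertex H r where
  sets i := c '' walkNeighborSet G i x
  nonempty i := (walkNeighborSet_nonempty hG i x).image c
  rooted := by
    refine ⟨c x, ?_, ?_⟩
    · rw [Fin.val_zero, walkNeighborSet_zero, Set.image_singleton]
    · rintro i _ ⟨z, ⟨p, hp⟩, rfl⟩
      exact ⟨p.map hc.toHom, (p.length_map hc.toHom).trans hp⟩

/-- The homomorphism to the dual root of `H` that corresponds to an odd walk homomorphism
to `H`. -/
def toDualRootHom (hc : IsOddWalkHom G H r c) (hG : ∀ v, ¬ G.IsIsolated v) :
    G →g dualRoot H r where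
  toFun := hc.dualRootVertex hG
  map_rel' h :=
    ⟨fun i => ⟨Set.image_mono (walkNeighborSet_subset_succ_of_adj h i),
        Set.image_mono (walkNeighborSet_subset_succ_of_adj h.symm i)⟩,
      fun j => hc.completelyJoined_image_walkNeighborSet h (Nat.le_of_lt_succ j.2)⟩

end IsOddWalkHom

namespace DualRootVertex

variable {V : Type*} {G : SimpleGraph V} {r : ℕ}

/-- The vertex `v` with `A_1 = {v}`. -/
noncomputable def root (A : DualRootVertex G r) : V := A.rooted.choose

theorem sets_zero (A : DualRootVertex G r) : A.sets 0 = {A.root} := A.rooted.choose_spec.1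

theorem root_mem_sets_of_walk {A B : DualRootVertex G r} (p : (dualRoot G r).Walk A B)
    (i : Fin (r + 1)) (hi : p.length = i) : A.root ∈ B.sets i := by
  induction i using Fin.induction generalizing B with
  | zero =>
    obtain rfl := SimpleGraph.Walk.eq_of_length_eq_zero hi
    exact A.sets_zero ▸ Set.mem_singleton A.root
  | succ i ih =>
    rw [Fin.val_succ] at hi
    have hp : ¬ p.Nil := fun h => by simp [SimpleGraph.Walk.length_eq_zero_iff.2 h] at hi
    have hlen : p.dropLast.length = i.castSucc := by
      rw [SimpleGraph.Walk.length_dropLast, hi, Nat.add_sub_cancel, Fin.val_castSucc]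
    exact ((p.adj_penultimate hp).1 i).1 (ih p.dropLast hlen)

theorem isOddWalkHom_root : IsOddWalkHom (dualRoot G r) G r root := by
  intro k hk A B p hp
  have hmid : (dualRoot G r).Adj (p.getVert k) (p.getVert (k + 1)) :=
    p.adj_getVert_succ (by omega)
  have hA : A.root ∈ (p.getVert k).sets ⟨k, by omega⟩ := by
    refine root_mem_sets_of_walk (p.take k) _ ?_
    rw [SimpleGraph.Walk.take_length]
    exact min_eq_left (by omega)
  have hB : B.root ∈ (p.getVert (k + 1)).sets ⟨k, by omega⟩ := by
    refine root_mem_sets_of_walk (p.drop (k + 1)).reverse _ ?_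
    rw [SimpleGraph.Walk.length_reverse, SimpleGraph.Walk.drop_length]
    dsimp only
    omega
  exact hmid.2 _ _ hA _ hB

end DualRootVertex

/-! ### Weights and potentials -/

section WalkWeight

variable {V R : Type*} {G : SimpleGraph V} {u v : V}

/-- The sum of `w x y` over the steps from `x` to `y` of a walk, each taken in the direction
in which the walk runs through it. -/
def walkWeight [AddMonoid R] (w : V → V → R) (p : G.Walk u v) : R :=
  (p.darts.map fun e => w e.fst e.snd).sum

@[simp]
theorem walkWeight_nil [AddMonoid R] (w : V → V → R) :
    walkWeight w (.nil : G.Walk u u) = 0 := rfl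

@[simp]
theorem walkWeight_cons [AddMonoid R] (w : V → V → R) {x : V} (h : G.Adj x u) (p : G.Walk u v) :
    walkWeight w (.cons h p) = w x u + walkWeight w p :=
  List.sum_cons

theorem walkWeight_take_add_drop [AddMonoid R] (w : V → V → R) (p : G.Walk u v) (m : ℕ) :
    walkWeight w (p.take m) + walkWeight w (p.drop m) = walkWeight w p := by
  simp only [walkWeight, SimpleGraph.Walk.darts_take, SimpleGraph.Walk.darts_drop, List.map_take,
    List.map_drop, List.sum_take_add_sum_drop]

theorem walkWeight_mul_sub_const [Ring R] (w : V → V → R) (a b : R) (p : G.Walk u v) :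
    walkWeight (fun x y => a * w x y - b) p = a * walkWeight w p - p.length * b := by
  induction p with
  | nil => simp
  | cons h p ih =>
    rw [walkWeight_cons, walkWeight_cons, ih, SimpleGraph.Walk.length_cons]
    push_cast
    noncomm_ring

section Preorder

variable [AddCommMonoid R] [Preorder R] [IsOrderedAddMonoid R] {w : V → V → R} {C : R}

theorem walkWeight_le (hw : ∀ x y, G.Adj x y → w x y ≤ C) (p : G.Walk u v) :
    walkWeight w p ≤ p.length • C := by
  simpa [walkWeight] using List.sum_le_card_nsmul (p.darts.map fun e => w e.fst e.snd) C
    (by simpa using fun e _ => hw _ _ e.adj)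

theorem le_walkWeight (hw : ∀ x y, G.Adj x y → C ≤ w x y) (p : G.Walk u v) :
    p.length • C ≤ walkWeight w p :=
  walkWeight_le (R := Rᵒᵈ) hw p

theorem walkWeight_le_of_nonpos_of_length_eq {q : ℕ} (hq : 0 < q) (hC : 0 ≤ C)
    (hw : ∀ x y, G.Adj x y → w x y ≤ C)
    (h : ∀ ⦃x y⦄ (p : G.Walk x y), p.length = q → walkWeight w p ≤ 0) (p : G.Walk u v) :
    walkWeight w p ≤ q • C := by
  induction hm : p.length using Nat.strong_induction_on generalizing u with
  | _ m ih =>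
    rcases lt_or_ge m q with hlt | hle
    · calc walkWeight w p ≤ m • C := hm ▸ walkWeight_le hw p
        _ ≤ q • C := nsmul_le_nsmul_left hC hlt.le
    · have hlen : (p.drop q).length = m - q := by rw [SimpleGraph.Walk.drop_length, hm]
      have htake : walkWeight w (p.take q) ≤ 0 :=
        h _ (by rw [SimpleGraph.Walk.take_length, hm, min_eq_left hle])
      have hdrop := ih (m - q) (by omega) (p.drop q) hlen
      rw [← walkWeight_take_add_drop w p q, ← zero_add (q • C)]
      exact add_le_add htake hdrop

end Preorder

section Potential

variable [ConditionallyCompleteLinearOrder R] [AddCommGroup R] [IsOrderedAddMonoid R]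
  {w : V → V → R}

theorem exists_potential_of_bddAbove
    (hw : ∀ x, BddAbove {s | ∃ y, ∃ p : G.Walk x y, walkWeight w p = s}) :
    ∃ h : V → R, ∀ x y, G.Adj x y → w x y + h y ≤ h x := by
  refine ⟨fun x => sSup {s | ∃ y, ∃ p : G.Walk x y, walkWeight w p = s}, fun x y hxy => ?_⟩
  rw [← le_sub_iff_add_le']
  refine csSup_le ⟨0, y, .nil, walkWeight_nil w⟩ ?_
  rintro _ ⟨z, p, rfl⟩
  rw [le_sub_iff_add_le']
  exact le_csSup (hw x) ⟨z, .cons hxy p, walkWeight_cons w hxy p⟩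

theorem exists_potential_of_nonpos_of_length_eq {C : R} {q : ℕ} (hq : 0 < q) (hC : 0 ≤ C)
    (hw : ∀ x y, G.Adj x y → w x y ≤ C)
    (h : ∀ ⦃x y⦄ (p : G.Walk x y), p.length = q → walkWeight w p ≤ 0) :
    ∃ h : V → R, ∀ x y, G.Adj x y → w x y + h y ≤ h x := by
  refine exists_potential_of_bddAbove fun x => ⟨q • C, ?_⟩
  rintro _ ⟨y, p, rfl⟩
  exact walkWeight_le_of_nonpos_of_length_eq hq hC hw h p

end Potential

end WalkWeight

/-! ### Displacement of walks on a circle -/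

/-- The length of the anticlockwise arc from `i` to `j` on a circle of length `n`. It is an
integer, so that it may exceed `n` once added up along a walk. -/
def cyclicGap {n : ℕ} (i j : Fin n) : ℤ := ((j : ℤ) - i) % n

theorem cyclicGap_modEq {n : ℕ} (i j : Fin n) : cyclicGap i j ≡ j - i [ZMOD n] :=
  Int.mod_modEq _ _

theorem cyclicGap_eq_sub_of_le {n : ℕ} {i j : Fin n} (h : i ≤ j) : cyclicGap i j = j - i := by
  have := j.2
  have : (i : ℕ) ≤ j := h
  exact Int.emod_eq_of_lt (by omega) (by omega)

theorem cyclicGap_eq_add_of_lt {n : ℕ} {i j : Fin n} (h : j < i) :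
    cyclicGap i j = n - (i - j) := by
  have := i.2
  have : (j : ℕ) < i := h
  rw [cyclicGap, ← Int.add_emod_right, Int.emod_eq_of_lt (by omega) (by omega)]
  ring

theorem cyclicGap_add_cyclicGap_swap {n : ℕ} {i j : Fin n} (h : i ≠ j) :
    cyclicGap i j + cyclicGap j i = n := by
  rcases h.lt_or_gt with h | h
  all_goals
    rw [cyclicGap_eq_add_of_lt h, cyclicGap_eq_sub_of_le h.le]
    ring

section CircularCompleteGraph

variable {V : Type*} {G : SimpleGraph V} {n d : ℕ}

theorem circularCompleteGraph_adj_iff (hd : 0 < d) {i j : Fin n} :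
    (circularCompleteGraph n d).Adj i j ↔ cyclicGap i j ∈ Set.Icc (d : ℤ) (n - d) := by
  simp only [circularCompleteGraph, Set.mem_Icc]
  rcases le_or_gt i j with h | h
  · have : (i : ℤ) ≤ j := by exact_mod_cast h
    rw [cyclicGap_eq_sub_of_le h, abs_of_nonpos (by omega)]
    omega
  · have : (j : ℤ) < i := by exact_mod_cast h
    rw [cyclicGap_eq_add_of_lt h, abs_of_pos (by omega)]
    omega

theorem circularCompleteGraph_adj_of_modEq (hd : 0 < d) {i j : Fin n} {t : ℤ}
    (ht : t ∈ Set.Icc (d : ℤ) (n - d)) (h : (j : ℤ) - i ≡ t [ZMOD n]) :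
    (circularCompleteGraph n d).Adj i j := by
  have hgap : cyclicGap i j = t := by
    rw [cyclicGap, h.eq]
    exact Int.emod_eq_of_lt (by linarith [ht.1]) (by linarith [ht.2])
  rwa [circularCompleteGraph_adj_iff hd, hgap]

theorem not_isIsolated_circularCompleteGraph (hd : 0 < d) (hnd : 2 * d ≤ n) (i : Fin n) :
    ¬ (circularCompleteGraph n d).IsIsolated i := by
  obtain ⟨j, hjn, hj⟩ := Int.existsUnique_equiv_nat ((i : ℤ) + d) (b := n) (by omega)
  refine SimpleGraph.Adj.not_isIsolated_left (v := ⟨j, by omega⟩)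
    (circularCompleteGraph_adj_of_modEq hd (t := d) ⟨le_rfl, by omega⟩ ?_)
  simpa using hj.sub_right (i : ℤ)

theorem nonempty_hom_circularCompleteGraph_of_modEq (hn : 0 < n) (hd : 0 < d) (f : V → ℤ)
    (hf : ∀ u v, G.Adj u v → ∃ t ∈ Set.Icc (d : ℤ) (n - d), f v - f u ≡ t [ZMOD n]) :
    Nonempty (G →g circularCompleteGraph n d) := by
  choose z hzn hz using fun v => Int.existsUnique_equiv_nat (f v) (b := n) (by omega)
  refine ⟨⟨fun v => ⟨z v, by exact_mod_cast hzn v⟩, fun {u v} huv => ?_⟩⟩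
  obtain ⟨t, ht, h⟩ := hf u v huv
  exact circularCompleteGraph_adj_of_modEq hd ht (((hz v).sub (hz u)).trans h)

/-- The total displacement of a walk whose vertices are placed by `c` on a circle of length `n`,
when each step moves anticlockwise. -/
def winding (c : V → Fin n) {u v : V} (p : G.Walk u v) : ℤ :=
  walkWeight (fun x y => cyclicGap (c x) (c y)) p

theorem winding_modEq (c : V → Fin n) {u v : V} (p : G.Walk u v) :
    winding c p ≡ c v - c u [ZMOD n] := by
  induction p with
  | nil => simp [winding]
  | @cons x y z h p ih =>
    simpa [winding] using (cyclicGap_modEq (c x) (c y)).add ih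

theorem winding_mem_Icc_of_hom (hd : 0 < d) (f : G →g circularCompleteGraph n d) {u v : V}
    (p : G.Walk u v) :
    winding f p ∈ Set.Icc ((p.length : ℤ) * d) (p.length * (n - d)) := by
  have hgap {x y : V} (h : G.Adj x y) := (circularCompleteGraph_adj_iff hd).1 (f.map_adj h)
  constructor
  · simpa [winding] using le_walkWeight (fun x y h => (hgap h).1) p
  · simpa [winding] using walkWeight_le (fun x y h => (hgap h).2) p

/-! ### From `K_{(2r+1)n/(rn+d)}` to the dual root -/

variable {r : ℕ}

theorem isOddWalkHom_id_circularCompleteGraph {e : ℕ} (he : 0 < e) (hnd : 2 * d ≤ n)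
    (h : e + r * n ≤ (2 * r + 1) * d) :
    IsOddWalkHom (circularCompleteGraph n d) (circularCompleteGraph n e) r id := by
  intro k hk x y p hp
  have hd : 0 < d := Nat.pos_of_mul_pos_left (lt_of_lt_of_le (by omega) h)
  obtain ⟨hlow, hhigh⟩ :
      winding id p ∈ Set.Icc ((2 * k + 1) * d : ℤ) ((2 * k + 1) * (n - d)) := by
    simpa [hp] using winding_mem_Icc_of_hom hd SimpleGraph.Hom.id p
  have hke : (e : ℤ) + k * n ≤ (2 * k + 1) * d := by
    have : (0 : ℤ) ≤ (r - k) * (n - 2 * d) := mul_nonneg (by omega) (by omega)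
    zify at h
    linarith
  exact circularCompleteGraph_adj_of_modEq he (t := winding id p - n * k)
    ⟨by linarith, by linarith⟩ (Int.modEq_sub_modulus_mul_iff.2 (winding_modEq id p).symm)

theorem circularCompleteGraph_adj_div {q : ℕ} (hq : 0 < q) (hd : 0 < d) {x y : Fin (q * n)}
    (h : (circularCompleteGraph (q * n) (q * d)).Adj x y) :
    (circularCompleteGraph n d).Adj ⟨x / q, Nat.div_lt_of_lt_mul x.2⟩
      ⟨y / q, Nat.div_lt_of_lt_mul y.2⟩ := by
  obtain ⟨hlow, hhigh⟩ := (circularCompleteGraph_adj_iff (Nat.mul_pos hq hd)).1 h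
  obtain ⟨k, hk⟩ := Int.modEq_iff_add_fac.1 (cyclicGap_modEq x y)
  set t := cyclicGap x y
  have hq' : (0 : ℤ) < q := by exact_mod_cast hq
  have hfloor (e : ℤ) : ((x : ℤ) + q * e) / q = x / q + e :=
    Int.add_mul_ediv_left _ _ hq'.ne'
  have hdiv_low : (x : ℤ) / q + d ≤ (x + t) / q := by
    rw [← hfloor]
    exact Int.ediv_le_ediv hq' (by push_cast at hlow; linarith)
  have hdiv_high : ((x : ℤ) + t) / q ≤ x / q + (n - d) := by
    rw [← hfloor]
    exact Int.ediv_le_ediv hq' (by push_cast at hhigh; linarith)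
  have hy : (y : ℤ) / q = (x + t) / q + n * k := by
    rw [← Int.add_mul_ediv_left _ _ hq'.ne']
    congr 1
    push_cast at hk
    linarith
  refine circularCompleteGraph_adj_of_modEq hd (t := (x + t) / q - x / q)
    ⟨by linarith, by linarith⟩ (Int.modEq_iff_add_fac.2 ⟨-k, ?_⟩)
  push_cast
  rw [hy]
  ring

/-- Division by `q`, from the circle of length `qn` to the circle of length `n`. -/
def circularCompleteGraphDivHom {q : ℕ} (hq : 0 < q) (hd : 0 < d) :
    circularCompleteGraph (q * n) (q * d) →g circularCompleteGraph n d where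
  toFun x := ⟨x / q, Nat.div_lt_of_lt_mul x.2⟩
  map_rel' := circularCompleteGraph_adj_div hq hd

theorem isOddWalkHom_circularCompleteGraphDivHom (hd : 0 < d) (hnd : 2 * d ≤ n) :
    IsOddWalkHom (circularCompleteGraph ((2 * r + 1) * n) (r * n + d)) (circularCompleteGraph n d) r
      (circularCompleteGraphDivHom (Nat.succ_pos (2 * r)) hd) :=
  (isOddWalkHom_id_circularCompleteGraph (by positivity) (by linarith) (by linarith)).hom_comp
    (circularCompleteGraphDivHom (Nat.succ_pos (2 * r)) hd)

/-! ### From the dual root to `K_{(2r+1)n/(rn+d)}` -/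

theorem mem_Icc_next_turn_of_modEq {n d k s t : ℤ} (h4 : n < 4 * d)
    (hs : s ∈ Set.Icc (k * n + 3 * d) (k * n + 3 * (n - d))) (ht : t ∈ Set.Icc d (n - d))
    (h : s ≡ t [ZMOD n]) : s ∈ Set.Icc ((k + 1) * n + d) ((k + 1) * n + (n - d)) := by
  obtain ⟨hs_low, hs_high⟩ := hs
  obtain ⟨ht_low, ht_high⟩ := ht
  obtain ⟨l, hl⟩ := Int.modEq_iff_add_fac.1 h.symm
  have hn : 0 < n := by linarith
  have hkl : k < l := lt_of_mul_lt_mul_left (by linarith) hn.le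
  have hlk : l < k + 2 := lt_of_mul_lt_mul_left (by linarith) hn.le
  obtain rfl : l = k + 1 := by omega
  constructor <;> linarith

namespace IsOddWalkHom

variable {c : V → Fin n}

theorem winding_mem_Icc (h4 : n < 4 * d) (hc : IsOddWalkHom G (circularCompleteGraph n d) r c)
    {k : ℕ} (hk : k ≤ r) {u v : V} (p : G.Walk u v) (hp : p.length = 2 * k + 1) :
    winding c p ∈ Set.Icc ((k : ℤ) * n + d) (k * n + (n - d)) := by
  have hd : 0 < d := by omega
  induction k generalizing u with
  | zero => simpa [hp] using winding_mem_Icc_of_hom hd hc.toHom p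
  | succ k ih =>
    obtain ⟨htake_low, htake_high⟩ :
        winding c (p.take 2) ∈ Set.Icc (2 * d : ℤ) (2 * (n - d)) := by
      have hlen : (p.take 2).length = 2 := by
        rw [SimpleGraph.Walk.take_length, hp]
        exact min_eq_left (by omega)
      simpa [hlen] using winding_mem_Icc_of_hom hd hc.toHom (p.take 2)
    obtain ⟨hdrop_low, hdrop_high⟩ := ih (by omega) (p.drop 2) (by
      rw [SimpleGraph.Walk.drop_length, hp]
      omega)
    have hadd : winding c (p.take 2) + winding c (p.drop 2) = winding c p :=
      walkWeight_take_add_drop _ p 2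
    have hends := (circularCompleteGraph_adj_iff hd).1 (hc (k + 1) hk p hp)
    have hmod := (winding_modEq c p).trans (cyclicGap_modEq (c u) (c v)).symm
    push_cast
    exact mem_Icc_next_turn_of_modEq (by omega) ⟨by linarith, by linarith⟩ hends hmod

theorem exists_potential_cyclicGap (h4 : n < 4 * d)
    (hc : IsOddWalkHom G (circularCompleteGraph n d) r c) :
    ∃ h : V → ℤ, ∀ u v, G.Adj u v →
      (2 * r + 1) * cyclicGap (c u) (c v) - (r * n + (n - d)) + h v ≤ h u := by
  refine exists_potential_of_nonpos_of_length_eq (q := 2 * r + 1) (C := (2 * r + 1) * n)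
    (Nat.succ_pos _) (by positivity) (fun u v huv => ?_) fun u v p hp => ?_
  · obtain ⟨hlow, hhigh⟩ := (circularCompleteGraph_adj_iff (by omega)).1 (hc.adj huv)
    have hmul : (2 * r + 1) * cyclicGap (c u) (c v) ≤ (2 * r + 1) * n := by
      gcongr
      linarith
    have hrn : (0 : ℤ) ≤ r * n := by positivity
    linarith
  · have hwind := (hc.winding_mem_Icc h4 le_rfl p hp).2
    rw [walkWeight_mul_sub_const, hp]
    push_cast
    rw [← mul_sub]
    exact mul_nonpos_of_nonneg_of_nonpos (by positivity) (sub_nonpos.2 hwind)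

theorem nonempty_hom_circularCompleteGraph (h4 : n < 4 * d)
    (hc : IsOddWalkHom G (circularCompleteGraph n d) r c) :
    Nonempty (G →g circularCompleteGraph ((2 * r + 1) * n) (r * n + d)) := by
  obtain ⟨h, hh⟩ := hc.exists_potential_cyclicGap h4
  rcases isEmpty_or_nonempty V with _ | ⟨⟨v₀⟩⟩
  · exact ⟨⟨isEmptyElim, fun {u} => isEmptyElim u⟩⟩
  have hn : 0 < n := (Nat.zero_le _).trans_lt (c v₀).2
  refine nonempty_hom_circularCompleteGraph_of_modEq (by positivity) (by omega)
    (fun u => (2 * r + 1) * c u + h u) fun u v huv => ?_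
  have hturn := cyclicGap_add_cyclicGap_swap (hc.adj huv).ne
  refine ⟨(2 * r + 1) * cyclicGap (c u) (c v) + (h v - h u), ⟨?_, ?_⟩, ?_⟩
  · have hvu := hh v u huv.symm
    rw [eq_sub_of_add_eq' hturn] at hvu
    push_cast
    linarith
  · have huv := hh u v huv
    push_cast
    linarith
  · have hgap :=
      ((cyclicGap_modEq (c u) (c v)).symm.mul_left' (c := 2 * r + 1)).add_right (h v - h u)
    push_cast
    convert hgap using 1
    ring

end IsOddWalkHom

end CircularCompleteGraph

theorem mainTheorem7 (n d r : ℕ) (hd : 0 < d) (hnd : 2 * d < n) (h4 : (n : ℚ) / (d : ℚ) < 4) :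
    HomEquivalent (dualRoot (circularCompleteGraph n d) r)
      (circularCompleteGraph ((2 * r + 1) * n) (r * n + d)) := by
  have h4' : n < 4 * d := by
    rw [div_lt_iff₀ (by exact_mod_cast hd)] at h4
    exact_mod_cast h4
  have hroot := DualRootVertex.isOddWalkHom_root (G := circularCompleteGraph n d) (r := r)
  have hdiv := isOddWalkHom_circularCompleteGraphDivHom (r := r) hd hnd.le
  have hnotIsolated :=
    not_isIsolated_circularCompleteGraph (n := (2 * r + 1) * n) (d := r * n + d)
      (by positivity) (by linarith)
  exact ⟨hroot.nonempty_hom_circularCompleteGraph h4', ⟨hdiv.toDualRootHom hnotIsolated⟩⟩
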